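/- Work in the computational basis $|00\rangle,|01\rangle,|10\rangle,|11\rangle$ of two qubits, and for real parameters $\varphi_j$ consider the unitary braid gates $$B_I=\begin{pmatrix}e^{i\varphi_1}&0&0&0\\0&0&e^{i\varphi_2}&0\\0&e^{i\varphi_3}&0&0\\0&0&0&e^{i\varphi_4}\end{pmatrix},\qquad B_{II}=\begin{pmatrix}0&0&0&e^{i\varphi_2}\\0&e^{i\varphi_1}&0&0\\0&0&e^{i\varphi_1}&0\\e^{i\varphi_3}&0&0&0\end{pmatrix},$$ $$B_{III}=\begin{pmatrix}\cos\varphi_1&0&0&\sin\varphi_1e^{i\varphi_2}\\0&-i\sin\varphi_1&-\cos\varphi_1&0\\0&-\cos\varphi_1&-i\sin\varphi_1&0\\-\sin\varphi_1e^{-i\varphi_2}&0&0&\cos\varphi_1\end{pmatrix},\qquad B_{IV}=\frac1{\sqrt2}\begin{pmatrix}1&0&0&e^{i\varphi_1}\\0&1&1&0\\0&-1&1&0\\-e^{-i\varphi_1}&0&0&1\end{pmatrix}.$$ Put $\phi_{I,1}=\frac12(-\varphi_1-\varphi_2+\varphi_3+\varphi_4)$, $\phi_{I,2}=\frac12(-\varphi_1+\varphi_2-\varphi_3+\varphi_4)$,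 $\phi_{I,3}=\frac12(-\varphi_1+\varphi_2+\varphi_3-\varphi_4)$, $\phi_{II,1}=\frac12(-\varphi_2+\varphi_3)$, $\phi_{II,2}=\frac12(-\varphi_2+2\varphi_1-\varphi_3)$. A unitary $U$ on two qubits is a *Clifford gate* if $UPU^\dagger$ lies in the Pauli group $\{\pm1,\pm i\}\cdot\{1,\sigma_x,\sigma_y,\sigma_z\}^{\otimes2}$ for every $P$ in that group. It is a *matchgate* if it acts as a unitary $A$ on $\mathrm{span}(|00\rangle,|11\rangle)$ and as a unitary $B$ on $\mathrm{span}(|01\rangle,|10\rangle)$ with $\det A=\det B$ (each taken in the listed basis). It is *dual-unitary* if also $\tilde U$ is unitary, where $\langle mn|\tilde U|ij\rangle=\langle jn|U|im\rangle$. Then, for all real values of the parameters: 1. $B_I$ is Clifford if and only if $\phi_{I,1},\phi_{I,2},\phi_{I,3}\in\frac\pi2\mathbb Z$; it is a matchgate if and only if $\phi_{I,3}\in\frac\pi2+\pi\mathbb Z$; it is always dual-unitary. 2. $B_{II}$ is Clifford if and only if $\phi_{II,1},\phi_{II,2}\in\frac\pi2\mathbb Z$; it is a matchgate if and only if $\phi_{II,2}\in\frac\pi2+\pi\mathbb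 Z$; it is always dual-unitary. 3. $B_{III}$ is Clifford if $\varphi_1\in\frac\pi4\mathbb Z$ and $\varphi_2\in\frac\pi2+\pi\mathbb Z$, and this condition is also necessary whenever $\varphi_1\notin\frac\pi2\mathbb Z$. In the remaining cases: if $\varphi_1\in\pi\mathbb Z$, then $B_{III}$ is Clifford for every $\varphi_2$; if $\varphi_1\in\frac\pi2+\pi\mathbb Z$, then $B_{III}$ is Clifford if and only if $\varphi_2\in\frac\pi2\mathbb Z$. $B_{III}$ is never a matchgate and always dual-unitary. 4. $B_{IV}$ is Clifford if and only if $\varphi_1\in\pi\mathbb Z$; it is always a matchgate and never dual-unitary. -/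

import Mathlib

open scoped Kronecker

noncomputable section

namespace BraidGates

/-- Operators on two qubits; the index `(a, b)` stands for the computational basis vector `|ab⟩`. -/
abbrev TwoQubit : Type := Matrix (Fin 2 × Fin 2) (Fin 2 × Fin 2) ℂ

/-- A `4 × 4` matrix written in the ordered basis `|00⟩, |01⟩, |10⟩, |11⟩`
(`finProdFinEquiv (a, b) = 2 * a + b`). -/
def ofBasis (M : Matrix (Fin 4) (Fin 4) ℂ) : TwoQubit :=
  Matrix.of fun p q => M (finProdFinEquiv p) (finProdFinEquiv q)

/-- The phase `e^{iθ}`. -/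
def phase (θ : ℝ) : ℂ := Complex.exp (Complex.I * (θ : ℂ))

/-- The first braid gate. -/
def BI (φ₁ φ₂ φ₃ φ₄ : ℝ) : TwoQubit := ofBasis
  !![phase φ₁, 0, 0, 0;
     0, 0, phase φ₂, 0;
     0, phase φ₃, 0, 0;
     0, 0, 0, phase φ₄]

/-- The second braid gate. -/
def BII (φ₁ φ₂ φ₃ : ℝ) : TwoQubit := ofBasis
  !![0, 0, 0, phase φ₂;
     0, phase φ₁, 0, 0;
     0, 0, phase φ₁, 0;
     phase φ₃, 0, 0, 0]

/-- The third braid gate. -/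
def BIII (φ₁ φ₂ : ℝ) : TwoQubit := ofBasis
  !![(Real.cos φ₁ : ℂ), 0, 0, (Real.sin φ₁ : ℂ) * phase φ₂;
     0, -Complex.I * (Real.sin φ₁ : ℂ), -(Real.cos φ₁ : ℂ), 0;
     0, -(Real.cos φ₁ : ℂ), -Complex.I * (Real.sin φ₁ : ℂ), 0;
     -(Real.sin φ₁ : ℂ) * phase (-φ₂), 0, 0, (Real.cos φ₁ : ℂ)]

/-- The fourth braid gate. -/
def BIV (φ₁ : ℝ) : TwoQubit := (1 / (Real.sqrt 2 : ℂ)) • ofBasis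
  !![1, 0, 0, phase φ₁;
     0, 1, 1, 0;
     0, -1, 1, 0;
     -phase (-φ₁), 0, 0, 1]

/-- The angle `φ_{I,1}`. -/
def phiI1 (φ₁ φ₂ φ₃ φ₄ : ℝ) : ℝ := (-φ₁ - φ₂ + φ₃ + φ₄) / 2

/-- The angle `φ_{I,2}`. -/
def phiI2 (φ₁ φ₂ φ₃ φ₄ : ℝ) : ℝ := (-φ₁ + φ₂ - φ₃ + φ₄) / 2

/-- The angle `φ_{I,3}`. -/
def phiI3 (φ₁ φ₂ φ₃ φ₄ : ℝ) : ℝ := (-φ₁ + φ₂ + φ₃ - φ₄) / 2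

/-- The angle `φ_{II,1}`. -/
def phiII1 (φ₂ φ₃ : ℝ) : ℝ := (-φ₂ + φ₃) / 2

/-- The angle `φ_{II,2}`. -/
def phiII2 (φ₁ φ₂ φ₃ : ℝ) : ℝ := (-φ₂ + 2 * φ₁ - φ₃) / 2

/-- `x` is an integer multiple of `c`, that is `x ∈ {k c : k ∈ ℤ}`. -/
def IsIntMultiple (c x : ℝ) : Prop := ∃ k : ℤ, x = (k : ℝ) * c

/-- The identity and the three Pauli matrices `σ_x, σ_y, σ_z`. -/
def pauli : Fin 4 → Matrix (Fin 2) (Fin 2) ℂ :=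
  ![1, !![0, 1; 1, 0], !![0, -Complex.I; Complex.I, 0], !![1, 0; 0, -1]]

/-- The two-qubit Pauli group `{±1, ±i} · {1, σ_x, σ_y, σ_z}^{⊗ 2}`, as a set of matrices. -/
def pauliGroup : Set TwoQubit :=
  {P | ∃ (n : Fin 4) (a b : Fin 4), P = Complex.I ^ (n : ℕ) • (pauli a ⊗ₖ pauli b)}

/-- A two-qubit Clifford gate: a unitary whose conjugation action preserves the Pauli group. -/
def IsClifford (U : TwoQubit) : Prop :=
  U ∈ Matrix.unitaryGroup (Fin 2 × Fin 2) ℂ ∧ ∀ P ∈ pauliGroup, U * P * star U ∈ pauliGroup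

/-- The X-type gate `G(A, B)` acting as `A` on the span of `|00⟩, |11⟩` and as `B` on the span
of `|01⟩, |10⟩`. -/
def xGate (A B : Matrix (Fin 2) (Fin 2) ℂ) : TwoQubit := ofBasis
  !![A 0 0, 0, 0, A 0 1;
     0, B 0 0, B 0 1, 0;
     0, B 1 0, B 1 1, 0;
     A 1 0, 0, 0, A 1 1]

/-- A matchgate: a gate `G(A, B)` with `A, B` unitary and `det A = det B`. -/
def IsMatchgate (U : TwoQubit) : Prop :=
  ∃ A ∈ Matrix.unitaryGroup (Fin 2) ℂ, ∃ B ∈ Matrix.unitaryGroup (Fin 2) ℂ,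
    A.det = B.det ∧ U = xGate A B

/-- The index change `⟨m n| Ũ |i j⟩ = ⟨j n| U |i m⟩`. -/
def dual (U : TwoQubit) : TwoQubit :=
  Matrix.of fun p q => U (q.2, p.2) (q.1, p.1)

/-- A dual-unitary gate: both `U` and `Ũ` are unitary. -/
def IsDualUnitary (U : TwoQubit) : Prop :=
  U ∈ Matrix.unitaryGroup (Fin 2 × Fin 2) ℂ ∧ dual U ∈ Matrix.unitaryGroup (Fin 2 × Fin 2) ℂ

end BraidGates

end

noncomputable section

namespace BraidGates

/-! The Clifford statements reduce to a few normal forms. The first two gates are a diagonal gate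
times a Clifford involution (`swapGate` or `evenFlipGate`), so the diagonal factor alone decides.
Conjugation by a diagonal gate fixes the `σ_z` generators and decorates the `σ_x` generators with
ratios of diagonal entries; `diagGate_isClifford_iff` says exactly when the result is still a Pauli
element. The third gate degenerates to the same form when `sin φ₁ = 0` or `cos φ₁ = 0`.

When `cos² φ₁ = sin² φ₁` and `e^{2iφ₂} = -1`, the third gate is a Pauli quarter-turn times a fixed
Clifford gate; the fourth gate is itself such a quarter-turn when `e^{iφ₁} = ±1`
(`isClifford_pauli_rotation`).

Necessity rests on two invariants of Pauli elements: every entry is zero or a fourth root of unity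
(`apply_eq_zero_or_of_mem`), and squares of entries do not change when the second bit of both row
and column is flipped (`apply_sq_right_of_mem`). For the last two gates it suffices to test them on
the conjugate of `σ_z ⊗ 1`.

The two blocks of a matchgate are determined by the gate, so that property is a comparison of
determinants. Dual-unitarity is a direct check after permuting entries. Angle conditions are handled
throughout as equations between powers of `phase`. -/

theorem ofBasis_mul (M N : Matrix (Fin 4) (Fin 4) ℂ) :
    ofBasis M * ofBasis N = ofBasis (M * N) := by
  ext p q
  simp only [ofBasis, Matrix.mul_apply, Matrix.of_apply]
  exact Equiv.sum_comp (finProdFinEquiv : Fin 2 × Fin 2 ≃ Fin 4)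
    fun k => M (finProdFinEquiv p) k * N k (finProdFinEquiv q)

theorem star_ofBasis (M : Matrix (Fin 4) (Fin 4) ℂ) : star (ofBasis M) = ofBasis (star M) := rfl

theorem smul_ofBasis (c : ℂ) (M : Matrix (Fin 4) (Fin 4) ℂ) : c • ofBasis M = ofBasis (c • M) := rfl

theorem ofBasis_one : ofBasis 1 = 1 := Matrix.submatrix_one_equiv finProdFinEquiv

theorem ofBasis_injective : Function.Injective ofBasis := fun M N h => by
  ext i j
  have := congrFun (congrFun h (finProdFinEquiv.symm i)) (finProdFinEquiv.symm j)
  simpa [ofBasis] using this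

theorem ofBasis_mem_unitaryGroup_iff (M : Matrix (Fin 4) (Fin 4) ℂ) :
    ofBasis M ∈ Matrix.unitaryGroup (Fin 2 × Fin 2) ℂ ↔ M * star M = 1 := by
  rw [Matrix.mem_unitaryGroup_iff, star_ofBasis, ofBasis_mul, ← ofBasis_one]
  exact ofBasis_injective.eq_iff

theorem kronecker_eq_ofBasis (A B : Matrix (Fin 2) (Fin 2) ℂ) :
    A ⊗ₖ B = ofBasis
      !![A 0 0 * B 0 0, A 0 0 * B 0 1, A 0 1 * B 0 0, A 0 1 * B 0 1;
         A 0 0 * B 1 0, A 0 0 * B 1 1, A 0 1 * B 1 0, A 0 1 * B 1 1;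
         A 1 0 * B 0 0, A 1 0 * B 0 1, A 1 1 * B 0 0, A 1 1 * B 0 1;
         A 1 0 * B 1 0, A 1 0 * B 1 1, A 1 1 * B 1 0, A 1 1 * B 1 1] := by
  ext ⟨i, j⟩ ⟨k, l⟩
  fin_cases i <;> fin_cases j <;> fin_cases k <;> fin_cases l <;> rfl

theorem neg_kronecker (A B : Matrix (Fin 2) (Fin 2) ℂ) : (-A) ⊗ₖ B = -(A ⊗ₖ B) := by
  rw [← neg_one_smul ℂ A, Matrix.smul_kronecker, neg_one_smul]

theorem kronecker_neg (A B : Matrix (Fin 2) (Fin 2) ℂ) : A ⊗ₖ (-B) = -(A ⊗ₖ B) := by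
  rw [← neg_one_smul ℂ B, Matrix.kronecker_smul, neg_one_smul]

/-! ### Pauli matrices and the two-qubit Pauli group -/

theorem pauli_mul_pauli (a b : Fin 4) :
    ∃ (n : ℕ) (c : Fin 4), pauli a * pauli b = Complex.I ^ n • pauli c := by
  have hI : Complex.I ^ 3 = -Complex.I := by rw [pow_succ, Complex.I_sq]; ring
  have key : ∀ a b : Fin 4,
      pauli a * pauli b = Complex.I ^ ((!![0, 0, 0, 0; 0, 0, 1, 3; 0, 3, 0, 1; 0, 1, 3, 0] :
        Matrix (Fin 4) (Fin 4) ℕ) a b) •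
        pauli ((!![0, 1, 2, 3; 1, 0, 3, 2; 2, 3, 0, 1; 3, 2, 1, 0] :
          Matrix (Fin 4) (Fin 4) (Fin 4)) a b) := by
    intro a b
    fin_cases a <;> fin_cases b <;> ext i j <;> fin_cases i <;> fin_cases j <;>
      simp [pauli, hI]
  exact ⟨_, _, key a b⟩

theorem pauli_comm_or_anticomm (a b : Fin 4) :
    pauli a * pauli b = pauli b * pauli a ∨ pauli a * pauli b = -(pauli b * pauli a) := by
  have key : ∀ a b : Fin 4,
      pauli a * pauli b = ((!![1, 1, 1, 1; 1, 1, -1, -1; 1, -1, 1, -1; 1, -1, -1, 1] :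
        Matrix (Fin 4) (Fin 4) ℂ) a b) • (pauli b * pauli a) := by
    intro a b
    fin_cases a <;> fin_cases b <;> ext i j <;> fin_cases i <;> fin_cases j <;>
      simp [pauli]
  rw [key a b]
  fin_cases a <;> fin_cases b <;> simp

theorem pauli_mul_self (a : Fin 4) : pauli a * pauli a = 1 := by
  fin_cases a <;> ext i j <;> fin_cases i <;> fin_cases j <;> simp [pauli]

theorem star_pauli (a : Fin 4) : star (pauli a) = pauli a := by
  fin_cases a <;> ext i j <;> fin_cases i <;> fin_cases j <;> simp [pauli]

/-- Each Pauli matrix is diagonal or antidiagonal with its two nonzero entries equal up to sign;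
adding 1 in `Fin 2` flips the bit. -/
theorem pauli_apply_sq (a : Fin 4) (i k : Fin 2) :
    pauli a (i + 1) (k + 1) ^ 2 = pauli a i k ^ 2 := by
  fin_cases a <;> fin_cases i <;> fin_cases k <;> simp [pauli]

theorem pauli_apply_eq_zero_or (a : Fin 4) (i k : Fin 2) :
    pauli a i k = 0 ∨ pauli a i k ^ 4 = 1 := by
  fin_cases a <;> fin_cases i <;> fin_cases k <;>
    simp [pauli, (show Even 4 by decide).neg_pow]

theorem I_pow_smul_mem_pauliGroup (n : ℕ) (a b : Fin 4) :
    Complex.I ^ n • (pauli a ⊗ₖ pauli b) ∈ pauliGroup :=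
  ⟨⟨n % 4, Nat.mod_lt _ (by norm_num)⟩, a, b, by rw [← Complex.I_pow_eq_pow_mod]⟩

theorem kronecker_mem_pauliGroup (a b : Fin 4) : pauli a ⊗ₖ pauli b ∈ pauliGroup := by
  simpa using I_pow_smul_mem_pauliGroup 0 a b

theorem I_pow_smul_mem {P : TwoQubit} (hP : P ∈ pauliGroup) (n : ℕ) :
    Complex.I ^ n • P ∈ pauliGroup := by
  obtain ⟨m, a, b, rfl⟩ := hP
  rw [smul_smul, ← pow_add]
  exact I_pow_smul_mem_pauliGroup _ a b

theorem I_smul_mem {P : TwoQubit} (hP : P ∈ pauliGroup) : Complex.I • P ∈ pauliGroup := by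
  simpa using I_pow_smul_mem hP 1

theorem neg_mem {P : TwoQubit} (hP : P ∈ pauliGroup) : -P ∈ pauliGroup := by
  simpa using I_pow_smul_mem hP 2

theorem mul_mem {P Q : TwoQubit} (hP : P ∈ pauliGroup) (hQ : Q ∈ pauliGroup) :
    P * Q ∈ pauliGroup := by
  obtain ⟨m, a, b, rfl⟩ := hP
  obtain ⟨n, c, d, rfl⟩ := hQ
  obtain ⟨k, e, he⟩ := pauli_mul_pauli a c
  obtain ⟨l, f, hf⟩ := pauli_mul_pauli b d
  rw [Matrix.smul_mul, Matrix.mul_smul, ← Matrix.mul_kronecker_mul, he, hf,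
    Matrix.smul_kronecker, Matrix.kronecker_smul]
  exact I_pow_smul_mem (I_pow_smul_mem (I_pow_smul_mem (I_pow_smul_mem
    (kronecker_mem_pauliGroup e f) _) _) _) _

theorem apply_eq_zero_or_of_mem {P : TwoQubit} (hP : P ∈ pauliGroup) (p q : Fin 2 × Fin 2) :
    P p q = 0 ∨ P p q ^ 4 = 1 := by
  obtain ⟨n, a, b, rfl⟩ := hP
  have hn : (Complex.I ^ (n : ℕ)) ^ 4 = 1 := by
    rw [← pow_mul, mul_comm, pow_mul, Complex.I_pow_four, one_pow]
  rcases pauli_apply_eq_zero_or a p.1 q.1 with h | h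
  · simp [Matrix.kroneckerMap_apply, h]
  rcases pauli_apply_eq_zero_or b p.2 q.2 with h' | h'
  · simp [Matrix.kroneckerMap_apply, h']
  · right
    simp [Matrix.kroneckerMap_apply, mul_pow, h, h', hn]

theorem apply_sq_right_of_mem {P : TwoQubit} (hP : P ∈ pauliGroup) (i j k l : Fin 2) :
    P (i, j + 1) (k, l + 1) ^ 2 = P (i, j) (k, l) ^ 2 := by
  obtain ⟨n, a, b, rfl⟩ := hP
  simp only [Matrix.smul_apply, Matrix.kroneckerMap_apply, smul_eq_mul, mul_pow, pauli_apply_sq]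

/-! ### Sufficient conditions for being Clifford -/

theorem IsClifford.mul {U V : TwoQubit} (hU : IsClifford U) (hV : IsClifford V) :
    IsClifford (U * V) := by
  refine ⟨(Matrix.unitaryGroup _ ℂ).mul_mem hU.1 hV.1, fun P hP => ?_⟩
  rw [star_mul, show U * V * P * (star V * star U) = U * (V * P * star V) * star U by noncomm_ring]
  exact hU.2 _ (hV.2 _ hP)

/-- A unitary is Clifford as soon as it maps a generating set of the Pauli group into it. -/
theorem isClifford_of_generators {U : TwoQubit} (hU : U ∈ Matrix.unitaryGroup (Fin 2 × Fin 2) ℂ)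
    (hXI : U * (pauli 1 ⊗ₖ pauli 0) * star U ∈ pauliGroup)
    (hIX : U * (pauli 0 ⊗ₖ pauli 1) * star U ∈ pauliGroup)
    (hZI : U * (pauli 3 ⊗ₖ pauli 0) * star U ∈ pauliGroup)
    (hIZ : U * (pauli 0 ⊗ₖ pauli 3) * star U ∈ pauliGroup) : IsClifford U := by
  have h1 : U * star U = 1 := Matrix.mem_unitaryGroup_iff.mp hU
  have h2 : star U * U = 1 := Matrix.mem_unitaryGroup_iff'.mp hU
  have hmul : ∀ P Q : TwoQubit, U * P * star U ∈ pauliGroup → U * Q * star U ∈ pauliGroup →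
      U * (P * Q) * star U ∈ pauliGroup := fun P Q hP hQ => by
    have : U * (P * Q) * star U = U * P * star U * (U * Q * star U) := by
      rw [show U * P * star U * (U * Q * star U) = U * P * (star U * U) * (Q * star U) by
        noncomm_ring, h2]
      noncomm_ring
    rw [this]
    exact mul_mem hP hQ
  have hsmul : ∀ P : TwoQubit, U * P * star U ∈ pauliGroup → ∀ n : ℕ,
      U * (Complex.I ^ n • P) * star U ∈ pauliGroup := fun P hP n => by
    rw [Matrix.mul_smul, Matrix.smul_mul]
    exact I_pow_smul_mem hP n
  have hone : (1 : TwoQubit) = pauli 0 ⊗ₖ pauli 0 := (Matrix.one_kronecker_one).symm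
  have hY : pauli 2 = Complex.I ^ 1 • (pauli 1 * pauli 3) := by
    ext i j; fin_cases i <;> fin_cases j <;> simp [pauli]
  have h00 : pauli 0 = pauli 0 * pauli 0 := (mul_one (1 : Matrix (Fin 2) (Fin 2) ℂ)).symm
  have hII : U * (pauli 0 ⊗ₖ pauli 0) * star U ∈ pauliGroup := by
    rw [← hone, mul_one, h1, hone]; exact kronecker_mem_pauliGroup 0 0
  have hL : ∀ a : Fin 4, U * (pauli a ⊗ₖ pauli 0) * star U ∈ pauliGroup := by
    intro a
    fin_cases a
    · exact hII
    · exact hXI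
    · change U * (pauli 2 ⊗ₖ pauli 0) * star U ∈ pauliGroup
      rw [hY, Matrix.smul_kronecker, h00, Matrix.mul_kronecker_mul]
      exact hsmul _ (hmul _ _ hXI hZI) 1
    · exact hZI
  have hR : ∀ a : Fin 4, U * (pauli 0 ⊗ₖ pauli a) * star U ∈ pauliGroup := by
    intro a
    fin_cases a
    · exact hII
    · exact hIX
    · change U * (pauli 0 ⊗ₖ pauli 2) * star U ∈ pauliGroup
      rw [hY, Matrix.kronecker_smul, h00, Matrix.mul_kronecker_mul]
      exact hsmul _ (hmul _ _ hIX hIZ) 1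
    · exact hIZ
  refine ⟨hU, ?_⟩
  rintro _ ⟨n, a, b, rfl⟩
  refine hsmul _ ?_ n
  have : pauli a ⊗ₖ pauli b = (pauli a ⊗ₖ pauli 0) * (pauli 0 ⊗ₖ pauli b) := by
    rw [← Matrix.mul_kronecker_mul]; simp [pauli]
  rw [this]
  exact hmul _ _ (hL a) (hR b)

/-- A quarter-turn generated by a Pauli operator is Clifford. -/
theorem isClifford_pauli_rotation {c z : ℂ} (hc : c * star c = 1 / 2)
    (hz : z = Complex.I ∨ z = -Complex.I) (a b : Fin 4) : IsClifford (c • (1 + z • (pauli a ⊗ₖ pauli b))) := by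
  set σ : TwoQubit := pauli a ⊗ₖ pauli b with hσ
  have hσσ : σ * σ = 1 := by
    rw [hσ, ← Matrix.mul_kronecker_mul, pauli_mul_self, pauli_mul_self, Matrix.one_kronecker_one]
  have hstar : star σ = σ := by
    change Matrix.conjTranspose _ = _
    rw [hσ, Matrix.conjTranspose_kronecker]
    exact congrArg₂ _ (star_pauli a) (star_pauli b)
  have hzz : z * z = -1 := by rcases hz with rfl | rfl <;> simp
  have hsz : star z = -z := by rcases hz with rfl | rfl <;> simp
  have hV : star (c • (1 + z • σ)) = star c • (1 - z • σ) := by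
    rw [star_smul, star_add, star_one, star_smul, hstar, hsz, neg_smul, sub_eq_add_neg]
  -- Since `z² = -1` and `star z = -z`, only the commutator carries the factor `z`. So a `Q`
  -- commuting with `σ` is fixed, and an anticommuting one goes to `z σ Q`.
  have hconj : ∀ Q : TwoQubit, c • (1 + z • σ) * Q * star (c • (1 + z • σ)) =
      (1 / 2 : ℂ) • (Q + σ * Q * σ + z • (σ * Q - Q * σ)) := by
    intro Q
    rw [hV, ← hc]
    simp only [Matrix.smul_mul, Matrix.mul_smul, smul_smul, mul_comm (star c)]
    congr 1
    simp only [add_mul, mul_sub, mul_one, one_mul, Matrix.smul_mul, Matrix.mul_smul, smul_smul, hzz,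
      smul_sub, neg_smul, one_smul]
    abel
  have hmem : σ ∈ pauliGroup := kronecker_mem_pauliGroup a b
  refine ⟨?_, ?_⟩
  · rw [Matrix.mem_unitaryGroup_iff]
    have := hconj 1
    rw [mul_one] at this
    rw [this, mul_one, one_mul, hσσ, sub_self, smul_zero, add_zero, ← two_smul ℂ, smul_smul]
    norm_num
  · rintro Q hQ
    have hcomm : σ * Q = Q * σ ∨ σ * Q = -(Q * σ) := by
      obtain ⟨n, d, e, rfl⟩ := hQ
      rw [Matrix.mul_smul, Matrix.smul_mul, hσ, ← Matrix.mul_kronecker_mul,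
        ← Matrix.mul_kronecker_mul]
      rcases pauli_comm_or_anticomm a d with h | h <;> rcases pauli_comm_or_anticomm b e with h' | h' <;>
        rw [h, h'] <;> simp [neg_kronecker, kronecker_neg]
    rw [hconj]
    rcases hcomm with h | h
    · rw [h, sub_self, mul_assoc, hσσ, smul_zero, add_zero, mul_one, ← two_smul ℂ, smul_smul]
      simpa using hQ
    · have h' : Q * σ = -(σ * Q) := by rw [h, neg_neg]
      rw [h', show σ * Q * σ = -Q by rw [h, neg_mul, mul_assoc, hσσ, mul_one], sub_neg_eq_add,
        add_neg_cancel, zero_add, ← two_smul ℂ, smul_smul, smul_smul]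
      rw [show (1 / 2 : ℂ) * z * 2 = z by ring]
      rcases hz with rfl | rfl
      · exact I_smul_mem (mul_mem hmem hQ)
      · rw [neg_smul]; exact neg_mem (I_smul_mem (mul_mem hmem hQ))

/-! ### Angle conditions as equations between phases -/

theorem phase_add (x y : ℝ) : phase (x + y) = phase x * phase y := by
  rw [phase, phase, phase, ← Complex.exp_add]; push_cast; ring_nf

theorem phase_zero : phase 0 = 1 := by simp [phase]

theorem phase_neg_mul (x : ℝ) : phase (-x) * phase x = 1 := by
  rw [← phase_add, neg_add_cancel, phase_zero]

theorem phase_mul_neg (x : ℝ) : phase x * phase (-x) = 1 := by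
  rw [mul_comm, phase_neg_mul]

theorem conj_phase (x : ℝ) : (starRingEnd ℂ) (phase x) = phase (-x) := by
  rw [phase, phase, ← Complex.exp_conj]; simp

theorem phase_ne_zero (x : ℝ) : phase x ≠ 0 := Complex.exp_ne_zero _

theorem phase_nat_mul (n : ℕ) (x : ℝ) : phase (n * x) = phase x ^ n := by
  rw [phase, phase, ← Complex.exp_nat_mul]; push_cast; ring_nf

theorem phase_eq_one_iff (x : ℝ) : phase x = 1 ↔ IsIntMultiple (2 * Real.pi) x := by
  rw [phase, Complex.exp_eq_one_iff]
  refine exists_congr fun n => ?_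
  rw [show (n : ℂ) * (2 * Real.pi * Complex.I) = Complex.I * ((n * (2 * Real.pi) : ℝ) : ℂ) by
    push_cast; ring, mul_right_inj' Complex.I_ne_zero, Complex.ofReal_inj]

theorem isIntMultiple_mul_iff {r : ℝ} (hr : r ≠ 0) (c x : ℝ) :
    IsIntMultiple (r * c) (r * x) ↔ IsIntMultiple c x :=
  exists_congr fun n => by rw [mul_left_comm, mul_right_inj' hr]

theorem phase_pow_eq_one_iff {n : ℕ} (hn : n ≠ 0) (x : ℝ) :
    phase x ^ n = 1 ↔ IsIntMultiple (2 * Real.pi / n) x := by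
  have hn' : (n : ℝ) ≠ 0 := Nat.cast_ne_zero.mpr hn
  rw [← phase_nat_mul, phase_eq_one_iff, ← isIntMultiple_mul_iff hn' (2 * Real.pi / n) x,
    mul_div_cancel₀ _ hn']

theorem phase_pi_div_two : phase (Real.pi / 2) = Complex.I := by
  rw [phase, mul_comm]; push_cast; exact Complex.exp_pi_div_two_mul_I

theorem phase_eq (x : ℝ) : phase x = (Real.cos x : ℂ) + (Real.sin x : ℂ) * Complex.I := by
  rw [phase, mul_comm, Complex.exp_mul_I]; push_cast; rfl

theorem IsIntMultiple.add {c x y : ℝ} (hx : IsIntMultiple c x) (hy : IsIntMultiple c y) :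
    IsIntMultiple c (x + y) := by
  obtain ⟨m, rfl⟩ := hx
  obtain ⟨n, rfl⟩ := hy
  exact ⟨m + n, by push_cast; ring⟩

theorem IsIntMultiple.sub {c x y : ℝ} (hx : IsIntMultiple c x) (hy : IsIntMultiple c y) :
    IsIntMultiple c (x - y) := by
  obtain ⟨m, rfl⟩ := hx
  obtain ⟨n, rfl⟩ := hy
  exact ⟨m - n, by push_cast; ring⟩

/-- `x ∈ π/2 + πℤ` exactly when `e^{2ix} = -1`. -/
theorem isIntMultiple_sub_pi_div_two_iff (x : ℝ) :
    IsIntMultiple Real.pi (x - Real.pi / 2) ↔ phase x ^ 2 = -1 := by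
  have h := phase_pow_eq_one_iff two_ne_zero (x - Real.pi / 2)
  rw [show 2 * Real.pi / ((2 : ℕ) : ℝ) = Real.pi by push_cast; ring] at h
  rw [← h]
  have : phase x = phase (x - Real.pi / 2) * Complex.I := by
    rw [← phase_pi_div_two, ← phase_add, sub_add_cancel]
  rw [this, mul_pow, Complex.I_sq, mul_neg_one, neg_inj]

theorem isIntMultiple_pi_iff (x : ℝ) : IsIntMultiple Real.pi x ↔ phase x ^ 2 = 1 := by
  rw [phase_pow_eq_one_iff two_ne_zero]; norm_num

theorem isIntMultiple_pi_div_two_iff (x : ℝ) :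
    IsIntMultiple (Real.pi / 2) x ↔ phase x ^ 4 = 1 := by
  rw [phase_pow_eq_one_iff four_ne_zero, show 2 * Real.pi / ((4 : ℕ) : ℝ) = Real.pi / 2 by
    push_cast; ring]

/-! ### Diagonal gates times Clifford involutions -/

/-- The diagonal gate. -/
def diagGate (a b c d : ℂ) : TwoQubit :=
  ofBasis !![a, 0, 0, 0; 0, b, 0, 0; 0, 0, c, 0; 0, 0, 0, d]

/-- The gate exchanging the two qubits. -/
def swapGate : TwoQubit :=
  ofBasis !![1, 0, 0, 0; 0, 0, 1, 0; 0, 1, 0, 0; 0, 0, 0, 1]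

theorem pow_four_eq_one {u : ℂ} (h : u ^ 4 = 1) :
    u = 1 ∨ u = -1 ∨ u = Complex.I ∨ u = -Complex.I := by
  have : (u - 1) * ((u + 1) * ((u - Complex.I) * (u + Complex.I))) = 0 := by
    linear_combination h + (1 - u ^ 2) * Complex.I_sq
  rcases mul_eq_zero.mp this with h | h
  · exact Or.inl (sub_eq_zero.mp h)
  rcases mul_eq_zero.mp h with h | h
  · exact Or.inr (Or.inl (eq_neg_of_add_eq_zero_left h))
  rcases mul_eq_zero.mp h with h | h
  · exact Or.inr (Or.inr (Or.inl (sub_eq_zero.mp h)))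
  · exact Or.inr (Or.inr (Or.inr (eq_neg_of_add_eq_zero_left h)))

/-- For a fourth root of unity `u`, the antidiagonal matrix with entries `star u`, `u` is `±σ_x` or
`±σ_y`, and the sign `v / u` selects `1` or `σ_z` for the other tensor factor. This puts the
conjugated `σ_x` generators in the form of Pauli elements. -/
theorem exists_pauli_of_pow_four {u v : ℂ} (hu : u ^ 4 = 1) (huv : v ^ 2 = u ^ 2) :
    ∃ (n : ℕ) (b c : Fin 4), (pauli c = !![1, 0; 0, 1] ∨ pauli c = !![1, 0; 0, -1]) ∧
      Complex.I ^ n * pauli b 0 0 = 0 ∧ Complex.I ^ n * pauli b 1 1 = 0 ∧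
      Complex.I ^ n * pauli b 1 0 = u ∧ Complex.I ^ n * pauli b 0 1 = star u ∧
      v = u * pauli c 1 1 := by
  obtain ⟨c, hc, hc'⟩ : ∃ c : Fin 4,
      (pauli c = !![1, 0; 0, 1] ∨ pauli c = !![1, 0; 0, -1]) ∧ v = u * pauli c 1 1 := by
    rcases sq_eq_sq_iff_eq_or_eq_neg.mp huv with h | h
    · exact ⟨0, Or.inl Matrix.one_fin_two, by simp [pauli, h]⟩
    · exact ⟨3, Or.inr rfl, by simp [pauli, h]⟩
  rcases pow_four_eq_one hu with rfl | rfl | rfl | rfl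
  · exact ⟨0, 1, c, hc, by simp [pauli], by simp [pauli], by simp [pauli], by simp [pauli], hc'⟩
  · exact ⟨2, 1, c, hc, by simp [pauli], by simp [pauli], by simp [pauli], by simp [pauli], hc'⟩
  · exact ⟨0, 2, c, hc, by simp [pauli], by simp [pauli], by simp [pauli], by simp [pauli], hc'⟩
  · exact ⟨2, 2, c, hc, by simp [pauli], by simp [pauli], by simp [pauli], by simp [pauli], hc'⟩

theorem flip_left_mem_pauliGroup {u v : ℂ} (hu : u ^ 4 = 1) (huv : v ^ 2 = u ^ 2) :
    ofBasis !![0, 0, star u, 0; 0, 0, 0, star v; u, 0, 0, 0; 0, v, 0, 0] ∈ pauliGroup := by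
  obtain ⟨n, b, c, hc, h1, h2, h3, h4, rfl⟩ := exists_pauli_of_pow_four hu huv
  convert I_pow_smul_mem_pauliGroup n b c using 1
  rw [kronecker_eq_ofBasis, smul_ofBasis]
  congr 1
  rcases hc with hc | hc <;> ext i j <;> fin_cases i <;> fin_cases j <;> simp_all

theorem flip_right_mem_pauliGroup {u v : ℂ} (hu : u ^ 4 = 1) (huv : v ^ 2 = u ^ 2) :
    ofBasis !![0, star u, 0, 0; u, 0, 0, 0; 0, 0, 0, star v; 0, 0, v, 0] ∈ pauliGroup := by
  obtain ⟨n, b, c, hc, h1, h2, h3, h4, rfl⟩ := exists_pauli_of_pow_four hu huv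
  convert I_pow_smul_mem_pauliGroup n c b using 1
  rw [kronecker_eq_ofBasis, smul_ofBasis]
  congr 1
  rcases hc with hc | hc <;> ext i j <;> fin_cases i <;> fin_cases j <;> simp_all

theorem pauli_kronecker_generators :
    pauli 1 ⊗ₖ pauli 0 = ofBasis !![0, 0, 1, 0; 0, 0, 0, 1; 1, 0, 0, 0; 0, 1, 0, 0] ∧
    pauli 0 ⊗ₖ pauli 1 = ofBasis !![0, 1, 0, 0; 1, 0, 0, 0; 0, 0, 0, 1; 0, 0, 1, 0] ∧
    pauli 3 ⊗ₖ pauli 0 = ofBasis !![1, 0, 0, 0; 0, 1, 0, 0; 0, 0, -1, 0; 0, 0, 0, -1] ∧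
    pauli 0 ⊗ₖ pauli 3 = ofBasis !![1, 0, 0, 0; 0, -1, 0, 0; 0, 0, 1, 0; 0, 0, 0, -1] := by
  refine ⟨?_, ?_, ?_, ?_⟩ <;> rw [kronecker_eq_ofBasis] <;> simp [pauli]

theorem conj_ofBasis (M N : Matrix (Fin 4) (Fin 4) ℂ) :
    ofBasis M * ofBasis N * star (ofBasis M) = ofBasis (M * N * star M) := by
  rw [star_ofBasis, ofBasis_mul, ofBasis_mul]

/-- The conjugates of `σ_x ⊗ 1` and `1 ⊗ σ_x` carry the pairs of ratios `c/a, d/b` and `b/a, d/c`.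
Each pair must consist of fourth roots of unity equal up to sign; both sign conditions are the
single equation `(ad/(bc))² = 1`. -/
theorem diagGate_isClifford_iff {a b c d : ℂ} (ha : a * star a = 1) (hb : b * star b = 1)
    (hc : c * star c = 1) (hd : d * star d = 1) :
    IsClifford (diagGate a b c d) ↔
      (c * star a) ^ 4 = 1 ∧ (b * star a) ^ 4 = 1 ∧ (a * d * star b * star c) ^ 2 = 1 := by
  obtain ⟨gXI, gIX, gZI, gIZ⟩ := pauli_kronecker_generators
  have eXI : diagGate a b c d * (pauli 1 ⊗ₖ pauli 0) * star (diagGate a b c d) =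
      ofBasis !![0, 0, star (c * star a), 0; 0, 0, 0, star (d * star b);
        c * star a, 0, 0, 0; 0, d * star b, 0, 0] := by
    rw [gXI, diagGate, conj_ofBasis]
    congr 1
    ext i j
    fin_cases i <;> fin_cases j <;> simp [Matrix.mul_apply, Fin.sum_univ_four, mul_comm]
  have eIX : diagGate a b c d * (pauli 0 ⊗ₖ pauli 1) * star (diagGate a b c d) =
      ofBasis !![0, star (b * star a), 0, 0; b * star a, 0, 0, 0;
        0, 0, 0, star (d * star c); 0, 0, d * star c, 0] := by
    rw [gIX, diagGate, conj_ofBasis]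
    congr 1
    ext i j
    fin_cases i <;> fin_cases j <;> simp [Matrix.mul_apply, Fin.sum_univ_four, mul_comm]
  constructor
  · intro h
    have hXI := h.2 _ (kronecker_mem_pauliGroup 1 0)
    have hIX := h.2 _ (kronecker_mem_pauliGroup 0 1)
    rw [eXI] at hXI
    rw [eIX] at hIX
    have h1 : c * star a = 0 ∨ (c * star a) ^ 4 = 1 := apply_eq_zero_or_of_mem hXI (1, 0) (0, 0)
    have h2 : b * star a = 0 ∨ (b * star a) ^ 4 = 1 := apply_eq_zero_or_of_mem hIX (0, 1) (0, 0)
    have h3 : (d * star b) ^ 2 = (c * star a) ^ 2 := apply_sq_right_of_mem hXI 1 0 0 0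
    have ha0 : star a ≠ 0 := right_ne_zero_of_mul_eq_one ha
    refine ⟨h1.resolve_left (mul_ne_zero (left_ne_zero_of_mul_eq_one hc) ha0),
      h2.resolve_left (mul_ne_zero (left_ne_zero_of_mul_eq_one hb) ha0), ?_⟩
    calc (a * d * star b * star c) ^ 2 = (a * star c) ^ 2 * (d * star b) ^ 2 := by ring
      _ = ((a * star a) * (c * star c)) ^ 2 := by rw [h3]; ring
      _ = 1 := by rw [ha, hc]; norm_num
  · rintro ⟨h1, h2, h3⟩
    refine isClifford_of_generators ?_ ?_ ?_ ?_ ?_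
    · rw [diagGate, ofBasis_mem_unitaryGroup_iff]
      simp only [Complex.star_def] at ha hb hc hd
      ext i j
      fin_cases i <;> fin_cases j <;>
        simp [Matrix.mul_apply, Fin.sum_univ_four, ha, hb, hc, hd]
    · rw [eXI]
      refine flip_left_mem_pauliGroup h1 ?_
      -- The terms after `h3` remove the factor `(a * star a * (c * star c)) ^ 2`, which is 1.
      linear_combination (c * star a) ^ 2 * h3 +
        (d * star b) ^ 2 * (-(a * star a * (c * star c)) - 1) * ha * (c * star c) +
        (d * star b) ^ 2 * (-(a * star a * (c * star c)) - 1) * hc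
    · rw [eIX]
      refine flip_right_mem_pauliGroup h2 ?_
      linear_combination (b * star a) ^ 2 * h3 +
        (d * star c) ^ 2 * (-(a * star a * (b * star b)) - 1) * ha * (b * star b) +
        (d * star c) ^ 2 * (-(a * star a * (b * star b)) - 1) * hb
    · convert kronecker_mem_pauliGroup 3 0 using 1
      rw [gZI, diagGate, conj_ofBasis]
      congr 1
      simp only [Complex.star_def] at ha hb hc hd
      ext i j
      fin_cases i <;> fin_cases j <;>
        simp [Matrix.mul_apply, Fin.sum_univ_four, ha, hb, hc, hd]
    · convert kronecker_mem_pauliGroup 0 3 using 1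
      rw [gIZ, diagGate, conj_ofBasis]
      congr 1
      simp only [Complex.star_def] at ha hb hc hd
      ext i j
      fin_cases i <;> fin_cases j <;>
        simp [Matrix.mul_apply, Fin.sum_univ_four, ha, hb, hc, hd]

theorem swapGate_isClifford : IsClifford swapGate := by
  obtain ⟨gXI, gIX, gZI, gIZ⟩ := pauli_kronecker_generators
  refine isClifford_of_generators ?_ ?_ ?_ ?_ ?_
  · rw [swapGate, ofBasis_mem_unitaryGroup_iff]
    ext i j
    fin_cases i <;> fin_cases j <;> simp [Matrix.mul_apply, Fin.sum_univ_four]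
  · convert kronecker_mem_pauliGroup 0 1 using 1
    rw [gXI, gIX, swapGate, conj_ofBasis]
    congr 1
    ext i j
    fin_cases i <;> fin_cases j <;> simp [Matrix.mul_apply, Fin.sum_univ_four]
  · convert kronecker_mem_pauliGroup 1 0 using 1
    rw [gXI, gIX, swapGate, conj_ofBasis]
    congr 1
    ext i j
    fin_cases i <;> fin_cases j <;> simp [Matrix.mul_apply, Fin.sum_univ_four]
  · convert kronecker_mem_pauliGroup 0 3 using 1
    rw [gZI, gIZ, swapGate, conj_ofBasis]
    congr 1
    ext i j
    fin_cases i <;> fin_cases j <;> simp [Matrix.mul_apply, Fin.sum_univ_four]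
  · convert kronecker_mem_pauliGroup 3 0 using 1
    rw [gZI, gIZ, swapGate, conj_ofBasis]
    congr 1
    ext i j
    fin_cases i <;> fin_cases j <;> simp [Matrix.mul_apply, Fin.sum_univ_four]

theorem pauli_kronecker_mul_self (a b : Fin 4) :
    (pauli a ⊗ₖ pauli b) * (pauli a ⊗ₖ pauli b) = 1 := by
  rw [← Matrix.mul_kronecker_mul, pauli_mul_self, pauli_mul_self, Matrix.one_kronecker_one]

theorem star_pauli_kronecker (a b : Fin 4) : star (pauli a ⊗ₖ pauli b) = pauli a ⊗ₖ pauli b := by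
  change Matrix.conjTranspose _ = _
  rw [Matrix.conjTranspose_kronecker]
  exact congrArg₂ _ (star_pauli a) (star_pauli b)

theorem pauli_kronecker_isClifford (a b : Fin 4) : IsClifford (pauli a ⊗ₖ pauli b) := by
  refine ⟨?_, fun P hP => ?_⟩
  · rw [Matrix.mem_unitaryGroup_iff, star_pauli_kronecker, pauli_kronecker_mul_self]
  · rw [star_pauli_kronecker]
    exact mul_mem (mul_mem (kronecker_mem_pauliGroup a b) hP) (kronecker_mem_pauliGroup a b)

/-- `U` is recovered as `(U * V) * V`, so closure under products gives both directions. -/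
theorem isClifford_mul_iff_of_involution {U V : TwoQubit} (hV : IsClifford V) (h : V * V = 1) :
    IsClifford (U * V) ↔ IsClifford U :=
  ⟨fun hUV => by simpa [mul_assoc, h] using hUV.mul hV, fun hU => hU.mul hV⟩

theorem phase_mul_star (x : ℝ) : phase x * star (phase x) = 1 := by
  rw [Complex.star_def, conj_phase, phase_mul_neg]

theorem phase_neg_pow_eq_one_iff (x : ℝ) (n : ℕ) : phase (-x) ^ n = 1 ↔ phase x ^ n = 1 := by
  have h : phase (-x) ^ n * phase x ^ n = 1 := by rw [← mul_pow, phase_neg_mul, one_pow]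
  constructor <;> intro h' <;> simpa [h'] using h

theorem diagGate_phase_isClifford_iff (α β γ δ : ℝ) :
    IsClifford (diagGate (phase α) (phase β) (phase γ) (phase δ)) ↔
      IsIntMultiple (Real.pi / 2) (γ - α) ∧ IsIntMultiple (Real.pi / 2) (β - α) ∧
      IsIntMultiple (Real.pi / 2) ((-α + β + γ - δ) / 2) := by
  rw [diagGate_isClifford_iff (phase_mul_star α) (phase_mul_star β) (phase_mul_star γ)
    (phase_mul_star δ)]
  simp only [Complex.star_def, conj_phase, ← phase_add, isIntMultiple_pi_div_two_iff,
    ← sub_eq_add_neg]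
  -- The sign of the half-angle is reversed so that the squared phase of `α + δ - β - γ` becomes its
  -- fourth power.
  rw [← phase_neg_pow_eq_one_iff ((-α + β + γ - δ) / 2) 4,
    show α + δ - β - γ = ((2 : ℕ) : ℝ) * -((-α + β + γ - δ) / 2) by push_cast; ring,
    phase_nat_mul, ← pow_mul]

theorem BI_eq (φ₁ φ₂ φ₃ φ₄ : ℝ) :
    BI φ₁ φ₂ φ₃ φ₄ = diagGate (phase φ₁) (phase φ₂) (phase φ₃) (phase φ₄) * swapGate := by
  rw [BI, diagGate, swapGate, ofBasis_mul]
  simp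

theorem swapGate_mul_self : swapGate * swapGate = 1 := by
  rw [swapGate, ofBasis_mul, ← ofBasis_one]
  congr 1
  ext i j
  fin_cases i <;> fin_cases j <;> simp [Matrix.mul_apply, Fin.sum_univ_four]

/-- The gate exchanging `|00⟩` and `|11⟩`. -/
def evenFlipGate : TwoQubit :=
  ofBasis !![0, 0, 0, 1; 0, 1, 0, 0; 0, 0, 1, 0; 1, 0, 0, 0]

theorem evenFlipGate_eq : evenFlipGate = (pauli 1 ⊗ₖ pauli 1) * swapGate := by
  rw [evenFlipGate, kronecker_eq_ofBasis, swapGate, ofBasis_mul]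
  simp [pauli]

theorem evenFlipGate_isClifford : IsClifford evenFlipGate := by
  rw [evenFlipGate_eq]
  exact (pauli_kronecker_isClifford 1 1).mul swapGate_isClifford

theorem evenFlipGate_mul_self : evenFlipGate * evenFlipGate = 1 := by
  rw [evenFlipGate, ofBasis_mul, ← ofBasis_one]
  congr 1
  ext i j
  fin_cases i <;> fin_cases j <;> simp [Matrix.mul_apply, Fin.sum_univ_four]

theorem BII_eq (φ₁ φ₂ φ₃ : ℝ) :
    BII φ₁ φ₂ φ₃ =
      diagGate (phase φ₂) (phase φ₁) (phase φ₁) (phase φ₃) * evenFlipGate := by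
  rw [BII, diagGate, evenFlipGate, ofBasis_mul]
  simp

theorem BI_isClifford_iff (φ₁ φ₂ φ₃ φ₄ : ℝ) :
    IsClifford (BI φ₁ φ₂ φ₃ φ₄) ↔
      IsIntMultiple (Real.pi / 2) (phiI1 φ₁ φ₂ φ₃ φ₄) ∧
      IsIntMultiple (Real.pi / 2) (phiI2 φ₁ φ₂ φ₃ φ₄) ∧
      IsIntMultiple (Real.pi / 2) (phiI3 φ₁ φ₂ φ₃ φ₄) := by
  rw [BI_eq, isClifford_mul_iff_of_involution swapGate_isClifford swapGate_mul_self,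
    diagGate_phase_isClifford_iff]
  -- Given the third condition, the diagonal criterion differs from the stated one only by adding
  -- the third angle to the other two, which is reversible over the integers.
  have e1 : φ₃ - φ₁ = phiI1 φ₁ φ₂ φ₃ φ₄ + phiI3 φ₁ φ₂ φ₃ φ₄ := by rw [phiI1, phiI3]; ring
  have e2 : φ₂ - φ₁ = phiI2 φ₁ φ₂ φ₃ φ₄ + phiI3 φ₁ φ₂ φ₃ φ₄ := by rw [phiI2, phiI3]; ring
  rw [e1, e2, show (-φ₁ + φ₂ + φ₃ - φ₄) / 2 = phiI3 φ₁ φ₂ φ₃ φ₄ from rfl]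
  constructor
  · rintro ⟨h1, h2, h3⟩
    exact ⟨by simpa using h1.sub h3, by simpa using h2.sub h3, h3⟩
  · rintro ⟨h1, h2, h3⟩
    exact ⟨h1.add h3, h2.add h3, h3⟩

theorem BII_isClifford_iff (φ₁ φ₂ φ₃ : ℝ) :
    IsClifford (BII φ₁ φ₂ φ₃) ↔
      IsIntMultiple (Real.pi / 2) (phiII1 φ₂ φ₃) ∧
      IsIntMultiple (Real.pi / 2) (phiII2 φ₁ φ₂ φ₃) := by
  rw [BII_eq, isClifford_mul_iff_of_involution evenFlipGate_isClifford evenFlipGate_mul_self,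
    diagGate_phase_isClifford_iff]
  -- The two middle diagonal entries coincide, so the first two conditions of the diagonal criterion
  -- are the same.
  have e1 : φ₁ - φ₂ = phiII1 φ₂ φ₃ + phiII2 φ₁ φ₂ φ₃ := by rw [phiII1, phiII2]; ring
  have e2 : (-φ₂ + φ₁ + φ₁ - φ₃) / 2 = phiII2 φ₁ φ₂ φ₃ := by rw [phiII2]; ring
  rw [e1, e2]
  constructor
  · rintro ⟨h1, -, h3⟩
    exact ⟨by simpa using h1.sub h3, h3⟩
  · rintro ⟨h1, h3⟩
    exact ⟨h1.add h3, h1.add h3, h3⟩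

/-! ### Matchgates and determinants of blocks -/

theorem xGate_injective {A A' B B' : Matrix (Fin 2) (Fin 2) ℂ} (h : xGate A B = xGate A' B') :
    A = A' ∧ B = B' := by
  have h' := ofBasis_injective h
  constructor <;> ext i j
  -- Basis positions 0 and 3 are `|00⟩` and `|11⟩`; 1 and 2 are `|01⟩` and `|10⟩`.
  · have := congrFun (congrFun h' (if i = 0 then 0 else 3)) (if j = 0 then 0 else 3)
    fin_cases i <;> fin_cases j <;> simpa using this
  · have := congrFun (congrFun h' (if i = 0 then 1 else 2)) (if j = 0 then 1 else 2)
    fin_cases i <;> fin_cases j <;> simpa using this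

theorem xGate_isMatchgate_iff (A B : Matrix (Fin 2) (Fin 2) ℂ) :
    IsMatchgate (xGate A B) ↔ A ∈ Matrix.unitaryGroup (Fin 2) ℂ ∧
      B ∈ Matrix.unitaryGroup (Fin 2) ℂ ∧ A.det = B.det := by
  constructor
  · rintro ⟨A', hA, B', hB, hdet, h⟩
    obtain ⟨rfl, rfl⟩ := xGate_injective h
    exact ⟨hA, hB, hdet⟩
  · rintro ⟨hA, hB, hdet⟩
    exact ⟨A, hA, B, hB, hdet, rfl⟩

theorem diag_mem_unitaryGroup (α β : ℝ) :
    !![phase α, 0; 0, phase β] ∈ Matrix.unitaryGroup (Fin 2) ℂ := by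
  rw [Matrix.mem_unitaryGroup_iff]
  ext i j
  fin_cases i <;> fin_cases j <;>
    simp [Matrix.mul_apply, conj_phase, phase_mul_neg]

theorem antidiag_mem_unitaryGroup (α β : ℝ) :
    !![0, phase α; phase β, 0] ∈ Matrix.unitaryGroup (Fin 2) ℂ := by
  rw [Matrix.mem_unitaryGroup_iff]
  ext i j
  fin_cases i <;> fin_cases j <;>
    simp [Matrix.mul_apply, conj_phase, phase_mul_neg]

/-- The ratio of the two products is the square of the phase of the half-angle, so the equation says
that this square is `-1`. -/
theorem phase_mul_eq_neg_iff (α β γ δ : ℝ) :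
    phase α * phase β = -(phase γ * phase δ) ↔
      IsIntMultiple Real.pi ((-α + γ + δ - β) / 2 - Real.pi / 2) := by
  have hpos : phase γ * phase δ = phase α * phase β * phase ((-α + γ + δ - β) / 2) ^ 2 := by
    rw [← phase_nat_mul, ← phase_add, ← phase_add, ← phase_add]
    congr 1
    push_cast; ring
  have h0 : phase α * phase β ≠ 0 := mul_ne_zero (phase_ne_zero α) (phase_ne_zero β)
  rw [isIntMultiple_sub_pi_div_two_iff, hpos]
  constructor
  · intro h
    apply mul_left_cancel₀ h0
    linear_combination h
  · intro h
    rw [h]; ring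

theorem BI_isMatchgate_iff (φ₁ φ₂ φ₃ φ₄ : ℝ) :
    IsMatchgate (BI φ₁ φ₂ φ₃ φ₄) ↔
      IsIntMultiple Real.pi (phiI3 φ₁ φ₂ φ₃ φ₄ - Real.pi / 2) := by
  have h : BI φ₁ φ₂ φ₃ φ₄ = xGate !![phase φ₁, 0; 0, phase φ₄] !![0, phase φ₂; phase φ₃, 0] := by
    simp [BI, xGate]
  rw [h, xGate_isMatchgate_iff, Matrix.det_fin_two_of, Matrix.det_fin_two_of]
  simp only [diag_mem_unitaryGroup, antidiag_mem_unitaryGroup, true_and, mul_zero, sub_zero,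
    zero_sub]
  exact phase_mul_eq_neg_iff φ₁ φ₄ φ₂ φ₃

theorem BII_isMatchgate_iff (φ₁ φ₂ φ₃ : ℝ) :
    IsMatchgate (BII φ₁ φ₂ φ₃) ↔ IsIntMultiple Real.pi (phiII2 φ₁ φ₂ φ₃ - Real.pi / 2) := by
  have h : BII φ₁ φ₂ φ₃ = xGate !![0, phase φ₂; phase φ₃, 0] !![phase φ₁, 0; 0, phase φ₁] := by
    simp [BII, xGate]
  rw [h, xGate_isMatchgate_iff, Matrix.det_fin_two_of, Matrix.det_fin_two_of]
  simp only [diag_mem_unitaryGroup, antidiag_mem_unitaryGroup, true_and, mul_zero, sub_zero,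
    zero_sub]
  -- Here the antidiagonal block is the even one, so the minus sign must first be moved to the other
  -- side.
  rw [eq_comm, eq_comm.trans (neg_eq_iff_eq_neg (a := phase φ₂ * phase φ₃)), phase_mul_eq_neg_iff φ₂ φ₃ φ₁ φ₁, phiII2]
  ring_nf

/-! ### Dual-unitarity, and the matchgate question for the last two gates -/

theorem dual_ofBasis (M : Matrix (Fin 4) (Fin 4) ℂ) :
    dual (ofBasis M) = ofBasis
      !![M 0 0, M 2 0, M 0 2, M 2 2;
         M 1 0, M 3 0, M 1 2, M 3 2;
         M 0 1, M 2 1, M 0 3, M 2 3;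
         M 1 1, M 3 1, M 1 3, M 3 3] := by
  ext ⟨i, j⟩ ⟨k, l⟩
  fin_cases i <;> fin_cases j <;> fin_cases k <;> fin_cases l <;> rfl

theorem BI_isDualUnitary (φ₁ φ₂ φ₃ φ₄ : ℝ) : IsDualUnitary (BI φ₁ φ₂ φ₃ φ₄) := by
  constructor
  · rw [BI, ofBasis_mem_unitaryGroup_iff]
    ext i j
    fin_cases i <;> fin_cases j <;>
      simp [Matrix.mul_apply, Fin.sum_univ_four, conj_phase, phase_mul_neg]
  · rw [BI, dual_ofBasis, ofBasis_mem_unitaryGroup_iff]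
    ext i j
    fin_cases i <;> fin_cases j <;>
      simp [Matrix.mul_apply, Fin.sum_univ_four, conj_phase, phase_mul_neg]

theorem BII_isDualUnitary (φ₁ φ₂ φ₃ : ℝ) : IsDualUnitary (BII φ₁ φ₂ φ₃) := by
  constructor
  · rw [BII, ofBasis_mem_unitaryGroup_iff]
    ext i j
    fin_cases i <;> fin_cases j <;>
      simp [Matrix.mul_apply, Fin.sum_univ_four, conj_phase, phase_mul_neg]
  · rw [BII, dual_ofBasis, ofBasis_mem_unitaryGroup_iff]
    ext i j
    fin_cases i <;> fin_cases j <;>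
      simp [Matrix.mul_apply, Fin.sum_univ_four, conj_phase, phase_mul_neg]

theorem BIII_isDualUnitary (φ₁ φ₂ : ℝ) : IsDualUnitary (BIII φ₁ φ₂) := by
  have hcs : Complex.cos φ₁ ^ 2 + Complex.sin φ₁ ^ 2 = 1 := Complex.cos_sq_add_sin_sq φ₁
  have hp := phase_mul_neg φ₂
  constructor
  · rw [BIII, ofBasis_mem_unitaryGroup_iff]
    ext i j
    fin_cases i <;> fin_cases j <;>
      simp [Matrix.mul_apply, Fin.sum_univ_four, conj_phase, ← Complex.cos_conj,
        ← Complex.sin_conj] <;> try ring1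
    · linear_combination hcs + Complex.sin φ₁ ^ 2 * hp
    · linear_combination hcs - Complex.sin φ₁ ^ 2 * Complex.I_sq
    · linear_combination hcs - Complex.sin φ₁ ^ 2 * Complex.I_sq
    · linear_combination hcs + Complex.sin φ₁ ^ 2 * hp
  · rw [BIII, dual_ofBasis, ofBasis_mem_unitaryGroup_iff]
    ext i j
    fin_cases i <;> fin_cases j <;>
      simp [Matrix.mul_apply, Fin.sum_univ_four, conj_phase, ← Complex.cos_conj,
        ← Complex.sin_conj] <;> try ring1
    · linear_combination hcs - Complex.sin φ₁ ^ 2 * Complex.I_sq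
    · linear_combination hcs + Complex.sin φ₁ ^ 2 * hp
    · linear_combination hcs + Complex.sin φ₁ ^ 2 * hp
    · linear_combination hcs - Complex.sin φ₁ ^ 2 * Complex.I_sq

theorem BIII_not_isMatchgate (φ₁ φ₂ : ℝ) : ¬ IsMatchgate (BIII φ₁ φ₂) := by
  have h : BIII φ₁ φ₂ = xGate
      !![(Real.cos φ₁ : ℂ), (Real.sin φ₁ : ℂ) * phase φ₂;
        -(Real.sin φ₁ : ℂ) * phase (-φ₂), (Real.cos φ₁ : ℂ)]
      !![-Complex.I * (Real.sin φ₁ : ℂ), -(Real.cos φ₁ : ℂ);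
        -(Real.cos φ₁ : ℂ), -Complex.I * (Real.sin φ₁ : ℂ)] := by
    simp [BIII, xGate]
  rw [h, xGate_isMatchgate_iff, Matrix.det_fin_two_of, Matrix.det_fin_two_of]
  rintro ⟨-, -, h⟩
  have hcs : (Real.cos φ₁ : ℂ) ^ 2 + (Real.sin φ₁ : ℂ) ^ 2 = 1 := by
    exact_mod_cast Real.cos_sq_add_sin_sq φ₁
  -- The even block has determinant 1 and the odd block determinant -1.
  have : (2 : ℂ) = 0 := by
    linear_combination h - 2 * hcs - (Real.sin φ₁ : ℂ) ^ 2 * phase_mul_neg φ₂ +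
      (Real.sin φ₁ : ℂ) ^ 2 * Complex.I_sq
  exact two_ne_zero this

theorem inv_sqrt_two_sq : (1 / (Real.sqrt 2 : ℂ)) * (1 / (Real.sqrt 2 : ℂ)) = 1 / 2 := by
  have : (Real.sqrt 2 : ℂ) * (Real.sqrt 2 : ℂ) = 2 := by
    exact_mod_cast Real.mul_self_sqrt zero_le_two
  rw [div_mul_div_comm, this, one_mul]

theorem star_inv_sqrt_two : star (1 / (Real.sqrt 2 : ℂ)) = 1 / (Real.sqrt 2 : ℂ) := by simp

theorem BIV_isMatchgate (φ₁ : ℝ) : IsMatchgate (BIV φ₁) := by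
  have h : BIV φ₁ = xGate
      ((1 / (Real.sqrt 2 : ℂ)) • !![1, phase φ₁; -phase (-φ₁), 1])
      ((1 / (Real.sqrt 2 : ℂ)) • !![1, 1; -1, 1]) := by
    rw [BIV, smul_ofBasis, xGate]
    congr 1
    ext i j
    fin_cases i <;> fin_cases j <;> simp
  rw [h, xGate_isMatchgate_iff]
  refine ⟨?_, ?_, ?_⟩
  · rw [Matrix.mem_unitaryGroup_iff, star_smul, Matrix.smul_mul, Matrix.mul_smul, smul_smul,
      star_inv_sqrt_two, inv_sqrt_two_sq]
    ext i j
    rw [Matrix.smul_apply, Matrix.mul_apply, Fin.sum_univ_two]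
    fin_cases i <;> fin_cases j <;>
      simp [conj_phase, phase_mul_neg, phase_neg_mul] <;> norm_num
  · rw [Matrix.mem_unitaryGroup_iff, star_smul, Matrix.smul_mul, Matrix.mul_smul, smul_smul,
      star_inv_sqrt_two, inv_sqrt_two_sq]
    ext i j
    rw [Matrix.smul_apply, Matrix.mul_apply, Fin.sum_univ_two]
    fin_cases i <;> fin_cases j <;> simp <;> norm_num
  · rw [Matrix.det_smul, Matrix.det_smul, Matrix.det_fin_two_of, Matrix.det_fin_two_of]
    congr 1
    linear_combination phase_mul_neg φ₁

theorem BIV_not_isDualUnitary (φ₁ : ℝ) : ¬ IsDualUnitary (BIV φ₁) := by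
  rintro ⟨-, h⟩
  rw [BIV, smul_ofBasis, dual_ofBasis, ofBasis_mem_unitaryGroup_iff] at h
  -- Rows 0 and 3 of the dual are equal and nonzero, hence not orthogonal.
  have := congrFun (congrFun h 0) 3
  simp [Matrix.mul_apply, Fin.sum_univ_four] at this

/-! ### Clifford criteria for the fourth and third gates -/

theorem conj_pauli_three_apply (M : Matrix (Fin 4) (Fin 4) ℂ) (p q : Fin 2 × Fin 2) :
    (ofBasis M * (pauli 3 ⊗ₖ pauli 0) * star (ofBasis M)) p q =
      M (finProdFinEquiv p) 0 * star (M (finProdFinEquiv q) 0) +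
      M (finProdFinEquiv p) 1 * star (M (finProdFinEquiv q) 1) -
      M (finProdFinEquiv p) 2 * star (M (finProdFinEquiv q) 2) -
      M (finProdFinEquiv p) 3 * star (M (finProdFinEquiv q) 3) := by
  rw [pauli_kronecker_generators.2.2.1, conj_ofBasis]
  simp [ofBasis, Matrix.mul_apply, Fin.sum_univ_four, sub_eq_add_neg]

/-- Two antidiagonal factors give an antidiagonal Kronecker product, so the rotation has the X shape
of the third and fourth gates. -/
theorem rotation_eq_ofBasis (c z : ℂ) {A B : Matrix (Fin 2) (Fin 2) ℂ} (hA : A 0 0 = 0)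
    (hA' : A 1 1 = 0) (hB : B 0 0 = 0) (hB' : B 1 1 = 0) :
    c • (1 + z • (A ⊗ₖ B)) = ofBasis
      !![c, 0, 0, c * (z * (A 0 1 * B 0 1));
         0, c, c * (z * (A 0 1 * B 1 0)), 0;
         0, c * (z * (A 1 0 * B 0 1)), c, 0;
         c * (z * (A 1 0 * B 1 0)), 0, 0, c] := by
  rw [kronecker_eq_ofBasis, smul_ofBasis, ← ofBasis_one]
  change ofBasis (c • (1 + z • _)) = _
  congr 1
  ext i j
  fin_cases i <;> fin_cases j <;> simp [hA, hA', hB, hB']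

theorem conj_pauli_three_mem {M : Matrix (Fin 4) (Fin 4) ℂ} (h : IsClifford (ofBasis M)) :
    ofBasis M * (pauli 3 ⊗ₖ pauli 0) * star (ofBasis M) ∈ pauliGroup :=
  h.2 _ (kronecker_mem_pauliGroup 3 0)

/-- Comparison of the even and odd off-diagonal entries of the conjugate of `σ_z ⊗ 1` by a
Clifford gate. -/
theorem sq_eq_sq_of_isClifford {M : Matrix (Fin 4) (Fin 4) ℂ} (h : IsClifford (ofBasis M)) :
    (M 1 0 * star (M 2 0) + M 1 1 * star (M 2 1) - M 1 2 * star (M 2 2) -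
      M 1 3 * star (M 2 3)) ^ 2 =
    (M 0 0 * star (M 3 0) + M 0 1 * star (M 3 1) - M 0 2 * star (M 3 2) -
      M 0 3 * star (M 3 3)) ^ 2 := by
  have h2 := apply_sq_right_of_mem (conj_pauli_three_mem h) 0 0 1 1
  rw [conj_pauli_three_apply, conj_pauli_three_apply] at h2
  exact h2

theorem BIV_isClifford_iff (φ₁ : ℝ) : IsClifford (BIV φ₁) ↔ IsIntMultiple Real.pi φ₁ := by
  have hr := inv_sqrt_two_sq
  have hs := star_inv_sqrt_two
  rw [isIntMultiple_pi_iff, BIV, smul_ofBasis]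
  generalize 1 / (Real.sqrt 2 : ℂ) = r at hr hs
  have hrr : r * star r = 1 / 2 := by rw [hs, hr]
  constructor
  · intro h
    -- The odd entry compared is `-1` and the even one is `-phase φ₁`, so equality of squares is the
    -- claim.
    have h2 := sq_eq_sq_of_isClifford h
    rw [Complex.star_def] at hs
    simp [conj_phase, hs] at h2
    have h4 : (r * r) ^ 2 = 1 / 4 := by rw [hr]; norm_num
    linear_combination -h2 + (4 - 4 * phase φ₁ ^ 2) * h4
  · intro h
    have hp := phase_mul_neg φ₁
    rcases sq_eq_sq_iff_eq_or_eq_neg.mp (h.trans (one_pow 2).symm) with h | h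
    · have h' : phase (-φ₁) = 1 := by simpa [h] using hp
      convert isClifford_pauli_rotation hrr (Or.inl rfl) 2 1 using 1
      rw [rotation_eq_ofBasis r _ rfl rfl rfl rfl, h, h']
      congr 1
      ext i j
      fin_cases i <;> fin_cases j <;> simp [pauli]
    · have h' : phase (-φ₁) = -1 := by
        rw [h] at hp
        linear_combination -hp
      convert isClifford_pauli_rotation hrr (Or.inr rfl) 1 2 using 1
      rw [rotation_eq_ofBasis r _ rfl rfl rfl rfl, h, h']
      congr 1
      ext i j
      fin_cases i <;> fin_cases j <;> simp [pauli]

theorem isIntMultiple_pi_div_four_iff (x : ℝ) :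
    IsIntMultiple (Real.pi / 4) x ↔ phase x ^ 8 = 1 := by
  rw [phase_pow_eq_one_iff (by norm_num), show 2 * Real.pi / ((8 : ℕ) : ℝ) = Real.pi / 4 by
    push_cast; ring]

theorem phase_sq_eq (x : ℝ) :
    phase x ^ 2 = ((Real.cos x ^ 2 - Real.sin x ^ 2 : ℝ) : ℂ) +
      ((2 * Real.cos x * Real.sin x : ℝ) : ℂ) * Complex.I := by
  rw [phase_eq]; push_cast
  linear_combination (Complex.sin x) ^ 2 * Complex.I_sq

theorem BIII_isClifford_of_isIntMultiple_pi {φ₁ : ℝ} (φ₂ : ℝ) (h : IsIntMultiple Real.pi φ₁) :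
    IsClifford (BIII φ₁ φ₂) := by
  have hs : Real.sin φ₁ = 0 := by
    obtain ⟨k, rfl⟩ := h
    exact Real.sin_int_mul_pi k
  have hc : (Real.cos φ₁ : ℂ) * (Real.cos φ₁ : ℂ) = 1 := by
    have := Real.cos_sq_add_sin_sq φ₁
    rw [hs] at this
    norm_cast
    linear_combination this
  have e : BIII φ₁ φ₂ = diagGate (Real.cos φ₁ : ℂ) (-(Real.cos φ₁ : ℂ)) (-(Real.cos φ₁ : ℂ))
      (Real.cos φ₁ : ℂ) * swapGate := by
    rw [BIII, diagGate, swapGate, ofBasis_mul, hs]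
    simp
  rw [e]
  generalize hC : (Real.cos φ₁ : ℂ) = c at hc
  have hstar : star c = c := by rw [← hC]; exact Complex.conj_ofReal _
  refine IsClifford.mul ((diagGate_isClifford_iff ?_ ?_ ?_ ?_).mpr ⟨?_, ?_, ?_⟩)
    swapGate_isClifford <;>
    simp [-Complex.star_def, hstar, hc] <;> norm_num

theorem BIII_isClifford_iff_of_isIntMultiple_pi_sub {φ₁ : ℝ} (φ₂ : ℝ)
    (h : IsIntMultiple Real.pi (φ₁ - Real.pi / 2)) :
    IsClifford (BIII φ₁ φ₂) ↔ IsIntMultiple (Real.pi / 2) φ₂ := by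
  have hc : Real.cos φ₁ = 0 := by
    obtain ⟨k, hk⟩ := h
    rw [show φ₁ = k * Real.pi + Real.pi / 2 by linarith, Real.cos_add_pi_div_two,
      Real.sin_int_mul_pi, neg_zero]
  have hs : (Real.sin φ₁ : ℂ) * (Real.sin φ₁ : ℂ) = 1 := by
    have := Real.cos_sq_add_sin_sq φ₁
    rw [hc] at this
    norm_cast
    linear_combination this
  have e : BIII φ₁ φ₂ = diagGate ((Real.sin φ₁ : ℂ) * phase φ₂)
      (-Complex.I * (Real.sin φ₁ : ℂ)) (-Complex.I * (Real.sin φ₁ : ℂ))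
      (-(Real.sin φ₁ : ℂ) * phase (-φ₂)) * evenFlipGate := by
    rw [BIII, diagGate, evenFlipGate, ofBasis_mul, hc]
    simp
  rw [e, isClifford_mul_iff_of_involution evenFlipGate_isClifford evenFlipGate_mul_self]
  generalize hS : (Real.sin φ₁ : ℂ) = s at hs
  have hstar : (starRingEnd ℂ) s = s := by rw [← hS]; exact Complex.conj_ofReal _
  have hp := phase_mul_neg φ₂
  have hI := Complex.I_sq
  rw [diagGate_isClifford_iff, isIntMultiple_pi_div_two_iff, ← phase_neg_pow_eq_one_iff]
  · have e1 : -Complex.I * s * star (s * phase φ₂) = -Complex.I * phase (-φ₂) := by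
      rw [Complex.star_def, map_mul, hstar, conj_phase]
      linear_combination -Complex.I * phase (-φ₂) * hs
    have e2 : s * phase φ₂ * (-s * phase (-φ₂)) * star (-Complex.I * s) *
        star (-Complex.I * s) = 1 := by
      simp only [Complex.star_def, map_mul, map_neg, hstar, Complex.conj_I]
      linear_combination -s ^ 4 * Complex.I ^ 2 * hp - s ^ 4 * hI + (s * s + 1) * hs
    rw [e1, e2, mul_pow, (show Even 4 by decide).neg_pow, Complex.I_pow_four, one_mul, one_pow]
    tauto
  · simp only [Complex.star_def, map_mul, hstar, conj_phase]
    linear_combination s * s * hp + hs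
  · simp only [Complex.star_def, map_mul, map_neg, hstar, Complex.conj_I]
    linear_combination -s * s * hI + hs
  · simp only [Complex.star_def, map_mul, map_neg, hstar, Complex.conj_I]
    linear_combination -s * s * hI + hs
  · simp only [Complex.star_def, map_mul, map_neg, hstar, conj_phase, neg_neg]
    linear_combination s * s * hp + hs

theorem BIII_isClifford_of_sq_eq {φ₁ φ₂ : ℝ} (h : Real.sin φ₁ ^ 2 = Real.cos φ₁ ^ 2)
    (h₂ : IsIntMultiple Real.pi (φ₂ - Real.pi / 2)) : IsClifford (BIII φ₁ φ₂) := by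
  have hcs := Real.cos_sq_add_sin_sq φ₁
  have hc : (Real.cos φ₁ : ℂ) * star (Real.cos φ₁ : ℂ) = 1 / 2 := by
    rw [Complex.star_def, Complex.conj_ofReal]
    have : Real.cos φ₁ * Real.cos φ₁ = 1 / 2 := by linarith
    rw [← Complex.ofReal_mul, this]; norm_num
  have hK : IsClifford (diagGate 1 (-1) (-1) 1 * swapGate) :=
    ((diagGate_isClifford_iff (by simp) (by simp) (by simp) (by simp)).mpr
      ⟨by norm_num, by norm_num, by norm_num⟩).mul swapGate_isClifford
  have hp := phase_mul_neg φ₂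
  -- As `sin φ₁ = ±cos φ₁`, the sign is absorbed into the quarter-turn `z = ±i`.
  obtain ⟨z, hz, hzc⟩ : ∃ z : ℂ, (z = Complex.I ∨ z = -Complex.I) ∧
      (Real.sin φ₁ : ℂ) * Complex.I = (Real.cos φ₁ : ℂ) * z := by
    rcases sq_eq_sq_iff_eq_or_eq_neg.mp h with h | h
    · exact ⟨_, Or.inl rfl, by rw [h]⟩
    · exact ⟨_, Or.inr rfl, by rw [h]; push_cast; ring⟩
  rw [isIntMultiple_sub_pi_div_two_iff] at h₂
  -- `phase φ₂ = i` gives a rotation about `σ_x ⊗ σ_x`, and `-i` one about `σ_y ⊗ σ_y`.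
  rcases sq_eq_sq_iff_eq_or_eq_neg.mp (h₂.trans Complex.I_sq.symm) with h₂ | h₂
  · have h' : phase (-φ₂) = -Complex.I := by
      rw [h₂] at hp
      linear_combination -Complex.I * hp + phase (-φ₂) * Complex.I_sq
    convert (isClifford_pauli_rotation hc hz 1 1).mul hK using 1
    rw [rotation_eq_ofBasis _ _ rfl rfl rfl rfl, diagGate, swapGate, ofBasis_mul, ofBasis_mul, BIII,
      h₂, h']
    congr 1
    ext i j
    fin_cases i <;> fin_cases j <;>
      simp [pauli, Matrix.mul_apply, Fin.sum_univ_four] at hzc ⊢ <;> linear_combination hzc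
  · have h' : phase (-φ₂) = Complex.I := by
      rw [h₂] at hp
      linear_combination Complex.I * hp + phase (-φ₂) * Complex.I_sq
    convert (isClifford_pauli_rotation hc hz 2 2).mul hK using 1
    rw [rotation_eq_ofBasis _ _ rfl rfl rfl rfl, diagGate, swapGate, ofBasis_mul, ofBasis_mul, BIII,
      h₂, h']
    congr 1
    ext i j
    fin_cases i <;> fin_cases j <;>
      simp [pauli, Matrix.mul_apply, Fin.sum_univ_four] at hzc ⊢ <;> linear_combination hzc

/-- This is the double-angle formula at `2x`, kept in terms of `cos 2x` and `sin 2x` as polynomials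
in `cos x` and `sin x`. -/
theorem phase_pow_four_eq (x : ℝ) :
    phase x ^ 4 = ((1 - 2 * (2 * Real.cos x * Real.sin x) ^ 2 : ℝ) : ℂ) +
      ((2 * (Real.cos x ^ 2 - Real.sin x ^ 2) * (2 * Real.cos x * Real.sin x) : ℝ) : ℂ) *
        Complex.I := by
  have h : ((Real.cos x : ℂ)) ^ 2 + (Real.sin x : ℂ) ^ 2 = 1 := by
    exact_mod_cast Real.cos_sq_add_sin_sq x
  rw [show phase x ^ 4 = (phase x ^ 2) ^ 2 by ring, phase_sq_eq]
  push_cast at h ⊢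
  linear_combination (2 * Complex.cos x * Complex.sin x) ^ 2 * Complex.I_sq +
    (Complex.cos x ^ 2 + Complex.sin x ^ 2 + 1) * h

theorem BIII_isClifford_of_isIntMultiple {φ₁ φ₂ : ℝ} (h₁ : IsIntMultiple (Real.pi / 4) φ₁)
    (h₂ : IsIntMultiple Real.pi (φ₂ - Real.pi / 2)) : IsClifford (BIII φ₁ φ₂) := by
  rw [isIntMultiple_pi_div_four_iff] at h₁
  -- `e^{8iφ₁} = 1` splits by `e^{4iφ₁} = ±1`: the value 1 gives the two degenerate forms, the value
  -- -1 gives the quarter-turn.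
  rcases sq_eq_sq_iff_eq_or_eq_neg.mp
    (show (phase φ₁ ^ 4) ^ 2 = 1 ^ 2 by rw [← pow_mul, h₁, one_pow]) with h | h
  · rcases sq_eq_sq_iff_eq_or_eq_neg.mp
      (show (phase φ₁ ^ 2) ^ 2 = 1 ^ 2 by rw [← pow_mul, h, one_pow]) with h | h
    · exact BIII_isClifford_of_isIntMultiple_pi φ₂ ((isIntMultiple_pi_iff φ₁).mpr h)
    · rw [BIII_isClifford_iff_of_isIntMultiple_pi_sub φ₂
        ((isIntMultiple_sub_pi_div_two_iff φ₁).mpr h), isIntMultiple_pi_div_two_iff]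
      rw [isIntMultiple_sub_pi_div_two_iff] at h₂
      rw [show phase φ₂ ^ 4 = (phase φ₂ ^ 2) ^ 2 by ring, h₂]
      norm_num
  · refine BIII_isClifford_of_sq_eq ?_ h₂
    rw [phase_pow_four_eq] at h
    have h' := congrArg Complex.re h
    simp only [Complex.add_re, Complex.ofReal_re, Complex.re_ofReal_mul, Complex.I_re, mul_zero,
      add_zero] at h'
    have hcs := Real.cos_sq_add_sin_sq φ₁
    have : (Real.cos φ₁ ^ 2 - Real.sin φ₁ ^ 2) ^ 2 = 0 := by
      simp only [Complex.neg_re, Complex.one_re] at h'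
      linear_combination (Real.cos φ₁ ^ 2 + Real.sin φ₁ ^ 2 + 1) * hcs + h' / 2
    linarith [pow_eq_zero_iff two_ne_zero |>.mp this]

theorem BIII_isClifford_iff_of_not_isIntMultiple {φ₁ : ℝ} (φ₂ : ℝ)
    (hn : ¬ IsIntMultiple (Real.pi / 2) φ₁) :
    IsClifford (BIII φ₁ φ₂) ↔
      IsIntMultiple (Real.pi / 4) φ₁ ∧ IsIntMultiple Real.pi (φ₂ - Real.pi / 2) := by
  refine ⟨fun h => ?_, fun h => BIII_isClifford_of_isIntMultiple h.1 h.2⟩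
  rw [isIntMultiple_pi_div_two_iff] at hn
  rw [BIII] at h
  have h1 := apply_eq_zero_or_of_mem (conj_pauli_three_mem h) (0, 0) (0, 0)
  rw [conj_pauli_three_apply, show finProdFinEquiv ((0 : Fin 2), (0 : Fin 2)) = (0 : Fin 4) from rfl]
    at h1
  have h2 := sq_eq_sq_of_isClifford h
  have hcs := Real.cos_sq_add_sin_sq φ₁
  have hp := phase_mul_neg φ₂
  have hus : 2 * Real.cos φ₁ * Real.sin φ₁ ≠ 0 := by
    intro h0
    apply hn
    rw [phase_pow_four_eq, h0]
    norm_num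
  -- The `(0,0),(0,0)` entry of the conjugated `σ_z ⊗ 1` is `cos 2φ₁`. It must vanish, since fourth
  -- power 1 would force `sin 2φ₁ = 0`, against `hus`.
  have ht : Real.cos φ₁ ^ 2 - Real.sin φ₁ ^ 2 = 0 := by
    simp [conj_phase, ← Complex.cos_conj, ← Complex.sin_conj] at h1
    have e : Complex.cos φ₁ * Complex.cos φ₁ - Complex.sin φ₁ * phase φ₂ *
        (Complex.sin φ₁ * phase (-φ₂)) = ((Real.cos φ₁ ^ 2 - Real.sin φ₁ ^ 2 : ℝ) : ℂ) := by
      push_cast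
      linear_combination -Complex.sin φ₁ ^ 2 * hp
    rw [e] at h1
    rcases h1 with h1 | h1
    · exact_mod_cast h1
    · exfalso
      have h1' : ((Real.cos φ₁ ^ 2 - Real.sin φ₁ ^ 2) ^ 2) ^ 2 = 1 := by
        rw [← pow_mul]; exact_mod_cast h1
      have h3 : (Real.cos φ₁ ^ 2 - Real.sin φ₁ ^ 2) ^ 2 = 1 :=
        (sq_eq_sq₀ (sq_nonneg _) zero_le_one).mp (h1'.trans (one_pow 2).symm)
      apply hus
      rw [← pow_eq_zero_iff two_ne_zero]
      linear_combination (Real.cos φ₁ ^ 2 + Real.sin φ₁ ^ 2 + 1) * hcs - h3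
  have hu : (2 * Real.cos φ₁ * Real.sin φ₁) ^ 2 = 1 := by
    linear_combination (Real.cos φ₁ ^ 2 + Real.sin φ₁ ^ 2 + 1) * hcs -
      (Real.cos φ₁ ^ 2 - Real.sin φ₁ ^ 2) * ht
  constructor
  · rw [isIntMultiple_pi_div_four_iff, show phase φ₁ ^ 8 = (phase φ₁ ^ 4) ^ 2 by ring,
      phase_pow_four_eq, hu, ht]
    norm_num
  · rw [isIntMultiple_sub_pi_div_two_iff]
    -- The squares compared in `h2` are `-sin² 2φ₁` and `sin² 2φ₁ · e^{2iφ₂}`; with `sin² 2φ₁ = 1`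
    -- this leaves `e^{2iφ₂} = -1`.
    have hu' : (2 * Complex.cos φ₁ * Complex.sin φ₁) ^ 2 = 1 := by
      rw [← Complex.ofReal_cos, ← Complex.ofReal_sin]
      exact_mod_cast hu
    simp [conj_phase, ← Complex.cos_conj, ← Complex.sin_conj] at h2
    linear_combination -h2 + (2 * Complex.cos φ₁ * Complex.sin φ₁) ^ 2 * Complex.I_sq -
      (phase φ₂ ^ 2 + 1) * hu'

end BraidGates

end

theorem mainTheorem7 :
    -- first gate
    (∀ φ₁ φ₂ φ₃ φ₄ : ℝ,
      (BraidGates.IsClifford (BraidGates.BI φ₁ φ₂ φ₃ φ₄) ↔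
        BraidGates.IsIntMultiple (Real.pi / 2) (BraidGates.phiI1 φ₁ φ₂ φ₃ φ₄) ∧
        BraidGates.IsIntMultiple (Real.pi / 2) (BraidGates.phiI2 φ₁ φ₂ φ₃ φ₄) ∧
        BraidGates.IsIntMultiple (Real.pi / 2) (BraidGates.phiI3 φ₁ φ₂ φ₃ φ₄)) ∧
      (BraidGates.IsMatchgate (BraidGates.BI φ₁ φ₂ φ₃ φ₄) ↔
        BraidGates.IsIntMultiple Real.pi (BraidGates.phiI3 φ₁ φ₂ φ₃ φ₄ - Real.pi / 2)) ∧
      BraidGates.IsDualUnitary (BraidGates.BI φ₁ φ₂ φ₃ φ₄)) ∧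
    -- second gate
    (∀ φ₁ φ₂ φ₃ : ℝ,
      (BraidGates.IsClifford (BraidGates.BII φ₁ φ₂ φ₃) ↔
        BraidGates.IsIntMultiple (Real.pi / 2) (BraidGates.phiII1 φ₂ φ₃) ∧
        BraidGates.IsIntMultiple (Real.pi / 2) (BraidGates.phiII2 φ₁ φ₂ φ₃)) ∧
      (BraidGates.IsMatchgate (BraidGates.BII φ₁ φ₂ φ₃) ↔
        BraidGates.IsIntMultiple Real.pi (BraidGates.phiII2 φ₁ φ₂ φ₃ - Real.pi / 2)) ∧
      BraidGates.IsDualUnitary (BraidGates.BII φ₁ φ₂ φ₃)) ∧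
    -- third gate
    (∀ φ₁ φ₂ : ℝ,
      (BraidGates.IsIntMultiple (Real.pi / 4) φ₁ ∧
          BraidGates.IsIntMultiple Real.pi (φ₂ - Real.pi / 2) →
        BraidGates.IsClifford (BraidGates.BIII φ₁ φ₂)) ∧
      (¬ BraidGates.IsIntMultiple (Real.pi / 2) φ₁ →
        (BraidGates.IsClifford (BraidGates.BIII φ₁ φ₂) ↔
          BraidGates.IsIntMultiple (Real.pi / 4) φ₁ ∧
          BraidGates.IsIntMultiple Real.pi (φ₂ - Real.pi / 2))) ∧
      (BraidGates.IsIntMultiple Real.pi (φ₁ - Real.pi / 2) →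
        (BraidGates.IsClifford (BraidGates.BIII φ₁ φ₂) ↔
          BraidGates.IsIntMultiple (Real.pi / 2) φ₂)) ∧
      (BraidGates.IsIntMultiple Real.pi φ₁ → BraidGates.IsClifford (BraidGates.BIII φ₁ φ₂)) ∧
      ¬ BraidGates.IsMatchgate (BraidGates.BIII φ₁ φ₂) ∧
      BraidGates.IsDualUnitary (BraidGates.BIII φ₁ φ₂)) ∧
    -- fourth gate
    (∀ φ₁ : ℝ,
      (BraidGates.IsClifford (BraidGates.BIV φ₁) ↔ BraidGates.IsIntMultiple Real.pi φ₁) ∧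
      BraidGates.IsMatchgate (BraidGates.BIV φ₁) ∧
      ¬ BraidGates.IsDualUnitary (BraidGates.BIV φ₁)) := by
  exact ⟨fun φ₁ φ₂ φ₃ φ₄ => ⟨BraidGates.BI_isClifford_iff φ₁ φ₂ φ₃ φ₄,
      BraidGates.BI_isMatchgate_iff φ₁ φ₂ φ₃ φ₄, BraidGates.BI_isDualUnitary φ₁ φ₂ φ₃ φ₄⟩,
    fun φ₁ φ₂ φ₃ => ⟨BraidGates.BII_isClifford_iff φ₁ φ₂ φ₃,
      BraidGates.BII_isMatchgate_iff φ₁ φ₂ φ₃, BraidGates.BII_isDualUnitary φ₁ φ₂ φ₃⟩,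
    fun φ₁ φ₂ => ⟨fun h => BraidGates.BIII_isClifford_of_isIntMultiple h.1 h.2,
      BraidGates.BIII_isClifford_iff_of_not_isIntMultiple φ₂,
      BraidGates.BIII_isClifford_iff_of_isIntMultiple_pi_sub φ₂,
      BraidGates.BIII_isClifford_of_isIntMultiple_pi φ₂,
      BraidGates.BIII_not_isMatchgate φ₁ φ₂, BraidGates.BIII_isDualUnitary φ₁ φ₂⟩,
    fun φ₁ => ⟨BraidGates.BIV_isClifford_iff φ₁, BraidGates.BIV_isMatchgate φ₁,
      BraidGates.BIV_not_isDualUnitary φ₁⟩⟩
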